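/- Let $R$ be a commutative local ring, not necessarily Noetherian, with maximal ideal $M$ and residue field $k=R/M$. Assume that $R$ is complete with respect to the $M$-adic topology, i.e. $R$ is Hausdorff in this topology and every Cauchy sequence converges; equivalently, the natural map $R\to\varprojlim_{n\ge 1}R/M^{n}$ is an isomorphism. Let $\pi:R\to k$ be the natural surjective ring map. (1) There is a ring homomorphism $s:k\to R$ with $\pi\circ s=\mathrm{id}_k$ if and only if $\operatorname{char}(R)=\operatorname{char}(k)$. (2) If $\operatorname{char}(R)\neq\operatorname{char}(k)$, then there is a group homomorphism $\sigma:k^{*}\to R^{*}$ with $\pi^{*}\circ\sigma=\mathrm{id}_{k^{*}}$, where $\pi^{*}:R^{*}\to k^{*}$ is the surjective homomorphism of unit groups induced by $\pi$. -/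

import Mathlib

/-! In equal characteristic `R` contains a prime field: it is killed by `p`, or `char k = 0` and
nonzero integers are units. Prime fields are perfect, so `k` is formally smooth over the prime field
and `id_k` lifts through the `R/M^n` to the complete ring `R`.

In unequal characteristic `char k = p > 0`. Each kernel of `(R/M^(n+1))ˣ → (R/M^n)ˣ`, `n ≥ 1`, is
killed by `p`, while `kˣ` has no `p`-torsion. Hence homomorphisms from `kˣ` lift one level at a
time, and completeness glues the lifts. -/

open MvPolynomial in
/-- The vanishing of `H¹(L_{S/R})`, expressed in the presentation of `S` by the polynomial ring on
all of its elements. -/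
lemma Algebra.subsingleton_h1Cotangent_iff_forall_pderiv (R S : Type*) [CommRing R] [CommRing S]
    [Algebra R S] :
    Subsingleton (Algebra.H1Cotangent R S) ↔
      ∀ f : MvPolynomial S R, aeval (_root_.id : S → S) f = 0 →
        (∀ i, aeval (_root_.id : S → S) (pderiv i f) = 0) →
        f ∈ RingHom.ker (aeval (R := R) (_root_.id : S → S)) ^ 2 := by
  let P := Algebra.Generators.self R S
  have hker : P.toExtension.ker = RingHom.ker (aeval (R := R) (_root_.id : S → S)) := rfl
  have hzero (f : P.toExtension.ker) : P.toExtension.cotangentComplex (.mk f) = 0 ↔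
      ∀ i, aeval (_root_.id : S → S) (pderiv i f.1) = 0 := by
    rw [← P.cotangentSpaceBasis.repr.map_eq_zero_iff, Finsupp.ext_iff]
    refine forall_congr' fun i ↦ ?_
    rw [Algebra.Extension.cotangentComplex_mk]
    exact Eq.congr (P.cotangentSpaceBasis_repr_one_tmul f.1 i) rfl
  refine (Algebra.Extension.subsingleton_h1Cotangent P.toExtension).trans ?_
  rw [injective_iff_map_eq_zero]
  constructor
  · intro h f hf hd
    exact (Algebra.Extension.Cotangent.mk_eq_zero_iff (P := P.toExtension) ⟨f, hf⟩).mp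
      (h _ ((hzero ⟨f, hf⟩).mpr hd))
  · intro h x hx
    obtain ⟨f, rfl⟩ := Algebra.Extension.Cotangent.mk_surjective x
    exact (Algebra.Extension.Cotangent.mk_eq_zero_iff f).mpr (h f.1 f.2 ((hzero f).mp hx))

open MvPolynomial in
/-- Every field extension of a perfect field is formally smooth. -/
theorem Algebra.FormallySmooth.of_perfectField_of_field (K L : Type*) [Field K] [PerfectField K]
    [Field L] [Algebra K L] : Algebra.FormallySmooth K L := by
  refine ⟨inferInstance, ?_⟩
  rw [Algebra.subsingleton_h1Cotangent_iff_forall_pderiv]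
  intro f hf hd
  -- The variables of `f` are elements of `L`, finitely many; the relation is tested over the
  -- subfield they generate, where the finitely generated case applies.
  let E := IntermediateField.adjoin K (f.vars : Set L)
  have : Algebra.EssFiniteType K E :=
    IntermediateField.essFiniteType_iff.mpr (IntermediateField.fg_adjoin_finset f.vars)
  obtain ⟨g, hg⟩ := exists_rename_eq_of_vars_subset_range f (Subtype.val : E → L)
    Subtype.val_injective fun x hx ↦ ⟨⟨x, IntermediateField.subset_adjoin K _ hx⟩, rfl⟩
  rw [← hg] at hf hd ⊢
  have hval (q : MvPolynomial E K) :
      aeval (_root_.id : L → L) (rename (Subtype.val : E → L) q) = (aeval (_root_.id : E → E) q : L) := by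
    rw [aeval_rename]
    exact (comp_aeval_apply (_root_.id : E → E) E.val q).symm
  have hmem := (Algebra.subsingleton_h1Cotangent_iff_forall_pderiv K E).mp inferInstance g
    (by rw [hval] at hf; exact_mod_cast hf) fun i ↦ by
      have := hd i
      rw [pderiv_rename Subtype.val_injective, hval] at this
      exact_mod_cast this
  have hle : RingHom.ker (aeval (R := K) (_root_.id : E → E)) ≤
      (RingHom.ker (aeval (R := K) (_root_.id : L → L))).comap (rename (Subtype.val : E → L)) := by
    intro q hq
    rw [RingHom.mem_ker] at hq
    rw [Ideal.mem_comap, RingHom.mem_ker, hval, hq, ZeroMemClass.coe_zero]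
  exact Ideal.le_comap_pow _ _ (Ideal.pow_right_mono hle 2 hmem)

/-- A complete local ring that is an algebra over a perfect field has a coefficient field. -/
theorem IsLocalRing.exists_residue_comp_eq_id_of_perfectField (K R : Type*) [Field K]
    [PerfectField K] [CommRing R] [IsLocalRing R] [IsAdicComplete (maximalIdeal R) R]
    [Algebra K R] :
    ∃ s : ResidueField R →+* R, (residue R).comp s = RingHom.id (ResidueField R) := by
  have := Algebra.FormallySmooth.of_perfectField_of_field K (ResidueField R)
  obtain ⟨g, hg⟩ := Algebra.FormallySmooth.exists_mkₐ_comp_eq_of_isAdicComplete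
    (I := maximalIdeal R) (AlgHom.id K (ResidueField R))
  exact ⟨g, RingHom.ext fun x ↦ congr($hg x)⟩

lemma IsLocalRing.ringChar_residueField_dvd (R : Type*) [CommRing R] [IsLocalRing R] :
    ringChar (ResidueField R) ∣ ringChar R :=
  ringChar.dvd (by rw [← map_natCast (residue R), ringChar.Nat.cast_ringChar, map_zero])

/-- A complete local ring of equal characteristic has a coefficient field. -/
theorem IsLocalRing.exists_residue_comp_eq_id_of_ringChar_eq (R : Type*) [CommRing R]
    [IsLocalRing R] [IsAdicComplete (maximalIdeal R) R]
    (h : ringChar R = ringChar (ResidueField R)) :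
    ∃ s : ResidueField R →+* R, (residue R).comp s = RingHom.id (ResidueField R) := by
  obtain h0 | hp := CharP.char_is_prime_or_zero (ResidueField R) (ringChar (ResidueField R)) |>.symm
  · have hk : CharZero (ResidueField R) := (CharP.ringChar_zero_iff_CharZero _).mp h0
    have : Nonempty (Algebra ℚ R) := by
      refine (EqualCharZero.nonempty_algebraRat_iff R).mpr fun I hI ↦ ?_
      let φ : R ⧸ I →+* ResidueField R := Ideal.Quotient.factor (le_maximalIdeal hI)
      exact ⟨fun m n h ↦ by simpa using congrArg φ h⟩
    obtain ⟨_⟩ := this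
    exact exists_residue_comp_eq_id_of_perfectField ℚ R
  · have := Fact.mk hp
    have : CharP R (ringChar (ResidueField R)) := h ▸ ringChar.charP R
    let := ZMod.algebra R (ringChar (ResidueField R))
    exact exists_residue_comp_eq_id_of_perfectField (ZMod (ringChar (ResidueField R))) R

/-- Injective homomorphisms between abelian groups of prime exponent have retractions. -/
lemma AddMonoidHom.exists_leftInverse_of_prime_exponent {V W : Type*} [AddCommGroup V]
    [AddCommGroup W] (p : ℕ) [Fact p.Prime] (hV : ∀ x : V, p • x = 0) (hW : ∀ x : W, p • x = 0)
    (j : V →+ W) (hj : Function.Injective j) : ∃ r : W →+ V, r.comp j = AddMonoidHom.id V := by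
  let : Module (ZMod p) V := AddCommGroup.zmodModule hV
  let : Module (ZMod p) W := AddCommGroup.zmodModule hW
  obtain ⟨r, hr⟩ := (j.toZModLinearMap p).exists_leftInverse_of_injective
    (LinearMap.ker_eq_bot.mpr hj)
  exact ⟨r.toAddMonoidHom, AddMonoidHom.ext fun x ↦ LinearMap.congr_fun hr x⟩

/-- An extension of an abelian group without `p`-torsion by an elementary abelian `p`-group
splits. -/
theorem AddMonoidHom.exists_rightInverse_of_prime_torsion {E A : Type*} [AddCommGroup E]
    [AddCommGroup A] (p : ℕ) [Fact p.Prime] (f : E →+ A) (hf : Function.Surjective f)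
    (hker : ∀ x ∈ f.ker, p • x = 0) (hA : ∀ a : A, p • a = 0 → a = 0) :
    ∃ s : A →+ E, f.comp s = AddMonoidHom.id A := by
  -- `ker f` meets `pE` trivially: if `f (p • e) = 0`, then `f e = 0`, so `p • e = 0`. An
  -- `𝔽_p`-linear retraction of `E/pE` onto `ker f` then splits `f`.
  let N : AddSubgroup E := (nsmulAddMonoidHom p : E →+ E).range
  have hN (x : E ⧸ N) : p • x = 0 := by
    obtain ⟨x, rfl⟩ := QuotientAddGroup.mk_surjective x
    exact (QuotientAddGroup.eq_zero_iff (p • x)).mpr ⟨x, rfl⟩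
  let j : f.ker →+ E ⧸ N := (QuotientAddGroup.mk' N).comp f.ker.subtype
  have hj : Function.Injective j := by
    rw [injective_iff_map_eq_zero]
    rintro ⟨x, hx⟩ hx0
    obtain ⟨e, rfl⟩ := (QuotientAddGroup.eq_zero_iff x).mp hx0
    have he : f e = 0 := hA _ (by rw [← map_nsmul]; exact hx)
    exact Subtype.ext (hker e he)
  obtain ⟨r, hr⟩ := j.exists_leftInverse_of_prime_exponent p
    (fun x ↦ Subtype.ext (hker x.1 x.2)) hN hj
  let ρ : E →+ E := f.ker.subtype.comp (r.comp (QuotientAddGroup.mk' N))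
  have hρ (x : E) (hx : x ∈ f.ker) : ρ x = x := congr(($hr ⟨x, hx⟩).1)
  have hfρ (x : E) : f (ρ x) = 0 := (r (QuotientAddGroup.mk' N x)).2
  refine ⟨f.liftOfSurjective hf ⟨AddMonoidHom.id E - ρ, fun x hx ↦ ?_⟩, ?_⟩
  · simp [AddMonoidHom.mem_ker, hρ x hx]
  · ext a
    obtain ⟨e, rfl⟩ := hf a
    simp [AddMonoidHom.liftOfRightInverse_comp_apply, hfρ]

/-- Homomorphisms from an abelian group without `p`-torsion lift along surjections whose kernel is
an elementary abelian `p`-group. -/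
theorem MonoidHom.exists_lift_of_prime_torsion {A G H : Type*} [CommGroup A] [CommGroup G]
    [CommGroup H] (p : ℕ) [Fact p.Prime] (q : G →* H) (hq : Function.Surjective q)
    (hker : ∀ x ∈ q.ker, x ^ p = 1) (hA : ∀ a : A, a ^ p = 1 → a = 1) (σ : A →* H) :
    ∃ τ : A →* G, q.comp τ = σ := by
  -- Lifting `σ` amounts to splitting the pullback of `q` along `σ`.
  let E : Subgroup (G × A) :=
    (q.comp (MonoidHom.fst G A)).eqLocus (σ.comp (MonoidHom.snd G A))
  let f : E →* A := (MonoidHom.snd G A).comp E.subtype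
  have hf : Function.Surjective f := fun a ↦
    let ⟨g, hg⟩ := hq (σ a)
    ⟨⟨(g, a), hg⟩, rfl⟩
  obtain ⟨s, hs⟩ := AddMonoidHom.exists_rightInverse_of_prime_torsion p
    (MonoidHom.toAdditive f) hf
    (fun x hx ↦ by
      obtain ⟨⟨g, a⟩, hx'⟩ := x
      have ha : a = 1 := hx
      subst ha
      have hg : g ∈ q.ker := Eq.trans hx' (map_one σ)
      exact Subtype.ext (Prod.ext (hker g hg) (one_pow p)))
    hA
  let s' : A →* E := MonoidHom.toAdditive.symm s
  refine ⟨(MonoidHom.fst G A).comp (E.subtype.comp s'), MonoidHom.ext fun a ↦ ?_⟩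
  have h1 : q (s' a).1.1 = σ (s' a).1.2 := (s' a).2
  have h2 : (s' a).1.2 = a := congr($hs a)
  rw [h2] at h1
  exact h1

namespace IsLocalRing

variable {R : Type*} [CommRing R] [IsLocalRing R]

lemma units_map_factorPow_surjective {m n : ℕ} (hm : m ≠ 0) (h : m ≤ n) :
    Function.Surjective
      (Units.map (Ideal.Quotient.factorPow (maximalIdeal R) h :
        R ⧸ maximalIdeal R ^ n →* R ⧸ maximalIdeal R ^ m)) := by
  intro u
  obtain ⟨a, ha⟩ := Ideal.Quotient.mk_surjective u.1
  have hau : IsUnit a := by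
    have hu := u.isUnit.map (Ideal.Quotient.factor (Ideal.pow_le_self hm))
    rw [← ha] at hu
    exact (isUnit_map_iff (residue R) a).mp hu
  refine ⟨(hau.map (Ideal.Quotient.mk (maximalIdeal R ^ n))).unit, Units.ext ?_⟩
  rw [← ha]
  rfl

/-- In `a ^ p - 1 = (a - 1)(1 + a + ⋯ + a ^ (p - 1))` the second factor reduces to `p = 0` in the
residue field, which gains one power of the maximal ideal. -/
lemma units_pow_eq_one_of_mem_ker_factorPow (p : ℕ) [CharP (ResidueField R) p] {n : ℕ} (hn : n ≠ 0)
    (u : (R ⧸ maximalIdeal R ^ (n + 1))ˣ)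
    (hu : u ∈ (Units.map (Ideal.Quotient.factorPow (maximalIdeal R) n.le_succ :
        R ⧸ maximalIdeal R ^ (n + 1) →* R ⧸ maximalIdeal R ^ n)).ker) : u ^ p = 1 := by
  obtain ⟨a, ha⟩ := Ideal.Quotient.mk_surjective u.1
  have h1 : a - 1 ∈ maximalIdeal R ^ n := by
    rw [← Ideal.Quotient.eq, map_one]
    have := congr(($hu).1)
    simpa [← ha] using this
  have h2 : ∑ i ∈ Finset.range p, a ^ i ∈ maximalIdeal R := by
    have hres : residue R a = 1 := by
      rw [← map_one (residue R)]
      exact Ideal.Quotient.eq.mpr (Ideal.pow_le_self hn h1)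
    rw [← residue_eq_zero_iff]
    simp [hres]
  have h3 : a ^ p - 1 ∈ maximalIdeal R ^ (n + 1) := by
    rw [← mul_geom_sum, pow_succ]
    exact Ideal.mul_mem_mul h1 h2
  refine Units.ext ?_
  rw [Units.val_pow_eq_pow_val, ← ha, ← map_pow, Units.val_one, ← map_one (Ideal.Quotient.mk _)]
  exact Ideal.Quotient.eq.mpr h3

end IsLocalRing

/-- A compatible family of monoid homomorphisms to the quotients by powers of `I` lifts to an
`I`-adically complete ring. -/
theorem IsAdicComplete.exists_monoidHom_lift {G S : Type*} [CommMonoid G] [CommRing S] (I : Ideal S)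
    [IsAdicComplete I S] (f : (n : ℕ) → G →* S ⧸ I ^ (n + 1))
    (hf : ∀ n x, Ideal.Quotient.factorPow I (n + 1).le_succ (f (n + 1) x) = f n x) :
    ∃ F : G →* S, ∀ n x, Ideal.Quotient.mk (I ^ (n + 1)) (F x) = f n x := by
  -- Extending to `ℤ[G]` turns monoid maps into ring maps, to which the universal property of the
  -- completion applies.
  let g (n : ℕ) : MonoidAlgebra ℤ G →+* S ⧸ I ^ (n + 1) :=
    (MonoidAlgebra.lift ℤ (S ⧸ I ^ (n + 1)) G (f n)).toRingHom
  have hg (n : ℕ) (x : G) : g n (MonoidAlgebra.of ℤ G x) = f n x :=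
    MonoidAlgebra.lift_of (f n) x
  have ha : StrictMono fun n : ℕ ↦ n + 1 := fun _ _ h ↦ Nat.succ_lt_succ h
  have hcomp {m : ℕ} : (Ideal.Quotient.factorPow I (ha.monotone m.le_succ)).comp (g (m + 1)) =
      g m := by
    refine MonoidAlgebra.ringHom_ext' (Subsingleton.elim _ _) (MonoidHom.ext fun x ↦ ?_)
    exact (congrArg _ (hg (m + 1) x)).trans ((hf m x).trans (hg m x).symm)
  refine ⟨((IsAdicComplete.StrictMono.liftRingHom I ha g hcomp : _ →* S)).comp
    (MonoidAlgebra.of ℤ G), fun n x ↦ ?_⟩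
  exact (IsAdicComplete.StrictMono.mk_liftRingHom I ha g hcomp _).trans (hg n x)

/-- The unit group of a complete local ring with residue field of prime characteristic splits over
the unit group of the residue field. -/
theorem IsLocalRing.exists_units_map_residue_comp_eq_id (R : Type*) [CommRing R] [IsLocalRing R]
    [IsAdicComplete (maximalIdeal R) R] (p : ℕ) [Fact p.Prime] [CharP (ResidueField R) p] :
    ∃ σ : (ResidueField R)ˣ →* Rˣ,
      (Units.map (residue R : R →* ResidueField R)).comp σ = MonoidHom.id (ResidueField R)ˣ := by
  -- Frobenius is injective on a field of characteristic `p`.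
  have htors (a : (ResidueField R)ˣ) (ha : a ^ p = 1) : a = 1 := by
    refine Units.ext (frobenius_inj (ResidueField R) p ?_)
    simpa [frobenius_def] using congr(($ha).1)
  have hstep (n : ℕ) (σ : (ResidueField R)ˣ →* (R ⧸ maximalIdeal R ^ (n + 1))ˣ) :
      ∃ τ : (ResidueField R)ˣ →* (R ⧸ maximalIdeal R ^ (n + 1 + 1))ˣ,
        (Units.map (Ideal.Quotient.factorPow (maximalIdeal R) (n + 1).le_succ :
          R ⧸ maximalIdeal R ^ (n + 1 + 1) →* R ⧸ maximalIdeal R ^ (n + 1))).comp τ = σ :=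
    MonoidHom.exists_lift_of_prime_torsion p _
      (units_map_factorPow_surjective n.succ_ne_zero (n + 1).le_succ)
      (units_pow_eq_one_of_mem_ker_factorPow p n.succ_ne_zero) htors σ
  choose next hnext using hstep
  let σ₀ : (ResidueField R)ˣ →* (R ⧸ maximalIdeal R ^ (0 + 1))ˣ :=
    Units.map (Ideal.quotEquivOfEq (pow_one (maximalIdeal R)).symm :
      R ⧸ maximalIdeal R →* R ⧸ maximalIdeal R ^ (0 + 1))
  let σ (n : ℕ) : (ResidueField R)ˣ →* (R ⧸ maximalIdeal R ^ (n + 1))ˣ := Nat.rec σ₀ next n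
  obtain ⟨F, hF⟩ := IsAdicComplete.exists_monoidHom_lift (maximalIdeal R)
    (fun n ↦ (Units.coeHom _).comp (σ n)) fun n x ↦ congr(($(hnext n (σ n)) x).1)
  refine ⟨F.toHomUnits, MonoidHom.ext fun x ↦ Units.ext ?_⟩
  obtain ⟨a, ha⟩ := residue_surjective x.1
  have h0 : Ideal.Quotient.mk (maximalIdeal R ^ (0 + 1)) (F x) =
      Ideal.Quotient.mk (maximalIdeal R ^ (0 + 1)) a := by
    rw [hF 0 x]
    change Ideal.quotEquivOfEq (pow_one (maximalIdeal R)).symm x.1 = _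
    rw [← ha]
    rfl
  change residue R (F x) = x.1
  rw [← ha]
  rw [Ideal.Quotient.eq, zero_add, pow_one] at h0
  exact Ideal.Quotient.eq.mpr h0

theorem theorem2 (R : Type*) [CommRing R] [IsLocalRing R]
    [IsAdicComplete (IsLocalRing.maximalIdeal R) R] :
    ((∃ s : IsLocalRing.ResidueField R →+* R,
        (IsLocalRing.residue R).comp s = RingHom.id (IsLocalRing.ResidueField R)) ↔
      ringChar R = ringChar (IsLocalRing.ResidueField R)) ∧
    (ringChar R ≠ ringChar (IsLocalRing.ResidueField R) →
      ∃ σ : (IsLocalRing.ResidueField R)ˣ →* Rˣ,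
        (Units.map (IsLocalRing.residue R : R →* IsLocalRing.ResidueField R)).comp σ =
          MonoidHom.id (IsLocalRing.ResidueField R)ˣ) := by
  refine ⟨⟨fun ⟨s, _⟩ ↦ ?_, IsLocalRing.exists_residue_comp_eq_id_of_ringChar_eq R⟩, fun hne ↦ ?_⟩
  · exact Nat.dvd_antisymm
      (ringChar.dvd (by rw [← map_natCast s, ringChar.Nat.cast_ringChar, map_zero]))
      (IsLocalRing.ringChar_residueField_dvd R)
  · obtain hp | h0 := CharP.char_is_prime_or_zero (IsLocalRing.ResidueField R)
      (ringChar (IsLocalRing.ResidueField R))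
    · have := Fact.mk hp
      exact IsLocalRing.exists_units_map_residue_comp_eq_id R _
    -- Residue characteristic `0` divides `ringChar R`, forcing equal characteristic.
    · refine absurd ?_ hne
      rw [h0]
      exact Nat.eq_zero_of_zero_dvd (h0 ▸ IsLocalRing.ringChar_residueField_dvd R)
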